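/- Consider three tanks $1,2,3$ and a server. Fluid is delivered to each tank at the constant rate $\frac13$ and is removed by the server at the constant rate $1$ from the tank at which the server is located; $v_i(t)$ is the volume in tank $i$ and the state $\mathbf v(t)=(v_1(t),v_2(t),v_3(t))$ lies in $\Delta=\{v_1,v_2,v_3\ge 0,\ v_1+v_2+v_3=1\}$. The server stays at a tank until that tank is empty; when tank $i$ is emptied at time $t$, the server moves at once to a tank $j\neq i$ with the largest scaled volume $d_{ij}v_j(t)$, where $d_{ij}>0$ ($i\ne j$) are parameters and a fixed rule, depending on $i$ and on the state, is used in the case of equality; the position of the server is right-continuous in time. The Poincaré map $F:\partial\Delta\to\partial\Delta$, $\partial\Delta=\{\mathbf v\in\Delta: v_i=0 \text{ for some } i\}$, sends $\mathbf p$ to the first point at a positive time on $\partial\Delta$ of the trajectory that starts at $\mathbf v(0)=\mathbf p$ with the server having just emptied a tank $i$ with $p_i=0$. The global attractor of $F$ is $$\omega(F)=\bigcup_{x\in\partial\Delta}\ \bigcap_{r\ge 0}\overline{\{F^k(x):k\ge r\}}.$$ Let $c=\sum_{i\ge 0}\zeta_i 4^{-(i+1)}$ be the base-$4$ Champernowne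 constant, where $\zeta=\zeta_0\zeta_1\ldots=1\,2\,3\,10\,11\,12\,13\,20\ldots$ is the concatenation of the base-$4$ expansions of the positive integers. Let $x_1=c-\frac14$, $x_2=c$, $x_3=c+\frac12$ and $$d_1=\frac1{3x_1}-1,\qquad d_2=\frac{2-3x_2}{3x_2-1},\qquad d_3=\frac{3-3x_3}{3x_3-2}.$$ Then $x_1\in(0,\frac13)$, $x_2\in(\frac13,\frac23)$, $x_3\in(\frac23,1)$ and $d_1,d_2,d_3>0$, and for every switched server system as above whose parameters satisfy $$\frac{d_{13}}{d_{12}}=d_1,\qquad \frac{d_{21}}{d_{23}}=d_2,\qquad \frac{d_{32}}{d_{31}}=d_3,$$ the Poincaré map $F:\partial\Delta\to\partial\Delta$ is well defined and its global attractor $\omega(F)$ is finite. -/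

import Mathlib

open Set Filter Topology

noncomputable section

/-- The real number `∑ w_i β^{-(i+1)}` whose base-`β` expansion is the infinite word `w`. -/
def ofExpansion (β : ℕ) (w : ℕ → ℕ) : ℝ := ∑' i : ℕ, (w i : ℝ) / (β : ℝ) ^ (i + 1)

/-- The concatenation of the base-`4` expansions (most significant digit first) of `1, 2, …, n`. -/
def champernownePrefix (n : ℕ) : List ℕ :=
  (List.range n).flatMap fun k => (Nat.digits 4 (k + 1)).reverse

/-- The infinite word `1 2 3 10 11 12 13 20 …` over `{0,1,2,3}`, letters numbered from `0`.
The expansions of `1, …, i + 1` have at least `i + 1` letters in total, so the letter number `i`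
occurs in that prefix. -/
def champernowneWord (i : ℕ) : ℕ := (champernownePrefix (i + 1)).getD i 0

/-- The base-`4` Champernowne constant. -/
def champernowne4 : ℝ := ofExpansion 4 champernowneWord

/-- The boundary `∂Δ` of the phase space `Δ = {v : v₁, v₂, v₃ ≥ 0, v₁ + v₂ + v₃ = 1}`, that is,
of `stdSimplex ℝ (Fin 3)`. The tanks `1, 2, 3` are numbered `0, 1, 2` here. -/
def boundaryΔ : Set (Fin 3 → ℝ) := {v | v ∈ stdSimplex ℝ (Fin 3) ∧ ∃ i, v i = 0}

/-- A switched server system with three tanks: the scaling parameters `d i j > 0`, `i ≠ j`, and the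
rule `next` which sends the server, when it has emptied tank `i` and the volumes are `v`, to a tank
`j ≠ i` with the largest scaled volume `d i j * v j`. (The rule carries only the information which
of the two tanks is taken if their scaled volumes are equal.) -/
structure SwitchedServer where
  d : Fin 3 → Fin 3 → ℝ
  d_pos : ∀ i j, i ≠ j → 0 < d i j
  next : Fin 3 → (Fin 3 → ℝ) → Fin 3
  next_ne : ∀ i v, next i v ≠ i
  next_max : ∀ i v j, j ≠ i → d i j * v j ≤ d i (next i v) * v (next i v)

/-- `v t` is the vector of volumes and `l t` the position of the server at the time `t ≥ 0`. -/
structure SwitchedServer.IsTrajectory (S : SwitchedServer) (v : ℝ → Fin 3 → ℝ) (l : ℝ → Fin 3) :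
    Prop where
  mem_simplex : ∀ t, 0 ≤ t → v t ∈ stdSimplex ℝ (Fin 3)
  continuousOn : ContinuousOn v (Ici 0)
  right_continuous : ∀ t, 0 ≤ t → ContinuousWithinAt l (Ici t) t
  /-- Every tank is filled at the rate `1/3`; the tank at the server is emptied at the rate `1`. -/
  flow : ∀ t, 0 ≤ t → ∀ i,
    HasDerivWithinAt (fun s => v s i) (1 / 3 - if l t = i then 1 else 0) (Ici t) t
  /-- The server does not move before its tank is empty. -/
  stay : ∀ s t, 0 ≤ s → s < t → (∀ u ∈ Ico s t, 0 < v u (l s)) → ∀ u ∈ Ico s t, l u = l s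
  /-- At the time at which its tank gets empty, the server moves according to the rule. -/
  switch : ∀ s t, 0 ≤ s → s < t → (∀ u ∈ Ico s t, 0 < v u (l s)) → v t (l s) = 0 →
    l t = S.next (l s) (v t)

/-- The trajectory starts at the point `p` of `∂Δ`, at a moment at which the server has just
emptied a tank `i` (and has moved on). -/
def SwitchedServer.IsTrajectoryFrom (S : SwitchedServer) (p : Fin 3 → ℝ)
    (v : ℝ → Fin 3 → ℝ) (l : ℝ → Fin 3) : Prop :=
  S.IsTrajectory v l ∧ v 0 = p ∧ ∃ i, p i = 0 ∧ l 0 = S.next i p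

/-- `τ` is the first positive time at which the curve `v` is on `∂Δ`. -/
def IsFirstReturnTime (v : ℝ → Fin 3 → ℝ) (τ : ℝ) : Prop :=
  0 < τ ∧ v τ ∈ boundaryΔ ∧ ∀ t ∈ Ioo 0 τ, v t ∉ boundaryΔ

/-- `F` is the Poincaré (first return) map of the flow on `∂Δ`: from every point `p` of `∂Δ` there
starts a trajectory, and every trajectory from `p` returns to `∂Δ` for the first time at `F p`. -/
def SwitchedServer.IsPoincareMap (S : SwitchedServer) (F : boundaryΔ → boundaryΔ) : Prop :=
  ∀ p : boundaryΔ, (∃ v l, S.IsTrajectoryFrom p v l) ∧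
    ∀ v l, S.IsTrajectoryFrom p v l → ∃ τ, IsFirstReturnTime v τ ∧ v τ = (F p : Fin 3 → ℝ)

/-- The global attractor `ω(F) = ⋃ₓ ω(x, F)`, where
`ω(x, F) = ⋂_{r ≥ 0} closure {F^k x : k ≥ r}`. -/
def globalAttractor {X : Type*} [TopologicalSpace X] (F : X → X) : Set X :=
  ⋃ x : X, omegaLimit atTop (fun (k : ℕ) (y : X) => F^[k] y) {x}

end

/-! The server drains the tank it has moved to completely, so in the coordinate `a` on the edges the
Poincaré map is piecewise affine with slopes of absolute value 1/2, and edge `e` is cut at one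
threshold `A e` (`returnMap_edgePoint`). The thresholds are `3 * x₁`, `3 * x₂ - 1`, `3 * x₃ - 2`. Of
the Champernowne constant only its first digits 1, 2, 3 are used: they place the thresholds in the
intervals [33/64, 36/64], [17/64, 20/64], [49/64, 52/64].

For all such thresholds every orbit reaches the segment `1/3 ≤ a ≤ 3/4` of edge 2
(`exists_iterate_mem_edge_two`). From there the edges visited are forced to be 2, 0, 1, 0, 2, and
the fourth iterate is the contraction `a ↦ (9 + a) / 16` with fixed point 3/5 (`return_cycle`). So
every orbit converges to one 4-cycle, which contains the attractor. The rule for ties plays no role: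
both branches are allowed at a threshold.

That the flow has this Poincaré map needs two facts: a trajectory cannot leave its first tank early
(`IsTrajectory.eq_drain`), and trajectories exist for all time because the drained volumes are
bounded below (`exists_le_next`). -/

/-! ### Numerical bounds for the Champernowne constant -/

lemma champernowneWord_le (i : ℕ) : champernowneWord i ≤ 3 := by
  unfold champernowneWord
  rw [List.getD_eq_getElem?_getD]
  rcases h : (champernownePrefix (i + 1))[i]? with _ | x
  · simp
  · have hx := List.mem_of_getElem? h
    simp only [champernownePrefix, List.mem_flatMap, List.mem_reverse] at hx
    obtain ⟨k, -, hk⟩ := hx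
    have := Nat.digits_lt_base (by norm_num : 1 < 4) hk
    simp only [Option.getD_some]
    omega

lemma champernowne4_mem : champernowne4 ∈ Icc (27 / 64 : ℝ) (28 / 64) := by
  -- The tail after three digits is at most that of the word 333…, while the digits 1, 2, 3
  -- contribute 27/64.
  have hgeo : HasSum (fun i : ℕ => (3 : ℝ) / 4 ^ (i + 4)) (1 / 64) := by
    have h := (hasSum_geometric_of_lt_one (r := (1 / 4 : ℝ)) (by norm_num) (by norm_num)).mul_left
      (3 / 256)
    rw [show (1 / 64 : ℝ) = 3 / 256 * (1 - 1 / 4)⁻¹ by norm_num,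
      show (fun i : ℕ => (3 : ℝ) / 4 ^ (i + 4)) = fun i => 3 / 256 * (1 / 4) ^ i from
        funext fun i => by rw [one_div_pow, pow_add]; field_simp; norm_num]
    exact h
  have hle : ∀ i : ℕ, (champernowneWord (i + 3) : ℝ) / ((4 : ℕ) : ℝ) ^ (i + 3 + 1)
      ≤ 3 / 4 ^ (i + 4) := by
    intro i
    have h : (champernowneWord (i + 3) : ℝ) ≤ 3 := by exact_mod_cast champernowneWord_le _
    push_cast
    gcongr
  have hnn : ∀ i : ℕ, 0 ≤ (champernowneWord (i + 3) : ℝ) / ((4 : ℕ) : ℝ) ^ (i + 3 + 1) :=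
    fun i => by positivity
  have hs := Summable.of_nonneg_of_le hnn hle hgeo.summable
  have hs' := (summable_nat_add_iff
    (f := fun i : ℕ => (champernowneWord i : ℝ) / ((4 : ℕ) : ℝ) ^ (i + 1)) 3).1 hs
  have hsum := hs'.sum_add_tsum_nat_add 3
  have hlo := tsum_nonneg (L := .unconditional ℕ) hnn
  have hhi := hs.tsum_le_tsum hle hgeo.summable
  rw [hgeo.tsum_eq] at hhi
  have e0 : champernowneWord 0 = 1 := by simp [champernowneWord, champernownePrefix]
  have e1 : champernowneWord 1 = 2 := by
    simp [champernowneWord, champernownePrefix, List.range_succ]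
  have e2 : champernowneWord 2 = 3 := by
    simp [champernowneWord, champernownePrefix, List.range_succ]
  simp only [Finset.sum_range_succ, Finset.sum_range_zero, e0, e1, e2] at hsum
  unfold champernowne4 ofExpansion
  rw [← hsum]
  constructor
  · norm_num at hlo ⊢
    linarith
  · norm_num at hhi ⊢
    linarith

/-! ### Draining one tank -/

/-- The volumes after a time `s` during which the server stays at tank `j`. -/
noncomputable def drain (p : Fin 3 → ℝ) (j : Fin 3) (s : ℝ) : Fin 3 → ℝ :=
  fun i => p i + s * (1 / 3 - if j = i then 1 else 0)

@[simp] lemma drain_zero (p : Fin 3 → ℝ) (j : Fin 3) : drain p j 0 = p := by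
  ext i; simp [drain]

lemma drain_self (p : Fin 3 → ℝ) (j : Fin 3) (s : ℝ) : drain p j s j = p j - 2 / 3 * s := by
  simp [drain]; ring

lemma drain_of_ne (p : Fin 3 → ℝ) {i j : Fin 3} (h : j ≠ i) (s : ℝ) :
    drain p j s i = p i + s / 3 := by
  simp [drain, h]; ring

lemma drain_mem {p : Fin 3 → ℝ} (hp : p ∈ stdSimplex ℝ (Fin 3)) {j : Fin 3} {s : ℝ}
    (h0 : 0 ≤ s) (hs : s ≤ 3 / 2 * p j) : drain p j s ∈ stdSimplex ℝ (Fin 3) := by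
  refine ⟨fun i => ?_, ?_⟩
  · by_cases h : j = i
    · subst h; rw [drain_self]; linarith
    · rw [drain_of_ne _ h]; linarith [hp.1 i]
  · have := hp.2
    rw [Fin.sum_univ_three] at this ⊢
    fin_cases j <;> simp [drain] <;> linarith

lemma continuous_drain (p : Fin 3 → ℝ) (j : Fin 3) : Continuous (drain p j) := by
  unfold drain; fun_prop

lemma hasDerivAt_drain (p : Fin 3 → ℝ) (j : Fin 3) (a t : ℝ) (i : Fin 3) :
    HasDerivAt (fun s => drain p j (s - a) i) (1 / 3 - if j = i then 1 else 0) t := by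
  unfold drain
  simpa using (((hasDerivAt_id t).sub_const a).mul_const
    (1 / 3 - if j = i then (1 : ℝ) else 0)).const_add (p i)

namespace SwitchedServer

variable (S : SwitchedServer)

/-! ### The switching rule -/

/-- Some tank holds at least 1/3, and the scaling parameters are finitely many positive numbers. The
uniformity of `δ` is what prevents switchings from accumulating in finite time. -/
lemma exists_le_next : ∃ δ > 0, ∀ i (p : Fin 3 → ℝ), p ∈ stdSimplex ℝ (Fin 3) → p i = 0 →
    δ ≤ p (S.next i p) := by
  -- Nothing is known about the diagonal of `d`; it is replaced by 1 so that extrema over all pairs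
  -- are positive.
  have hpos : ∀ x : Fin 3 × Fin 3, 0 < if x.1 = x.2 then 1 else S.d x.1 x.2 := by
    intro x
    split_ifs with h
    · exact one_pos
    · exact S.d_pos _ _ h
  obtain ⟨x, hx⟩ := Finite.exists_min fun x : Fin 3 × Fin 3 => if x.1 = x.2 then 1 else S.d x.1 x.2
  obtain ⟨y, hy⟩ := Finite.exists_max fun x : Fin 3 × Fin 3 => if x.1 = x.2 then 1 else S.d x.1 x.2
  have hm := hpos x
  have hM := hpos y
  set m := if x.1 = x.2 then 1 else S.d x.1 x.2
  set M := if y.1 = y.2 then 1 else S.d y.1 y.2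
  refine ⟨m / (3 * M), by positivity, fun i p hp hi => ?_⟩
  have key : ∀ k, m * p k ≤ M * p (S.next i p) := by
    intro k
    by_cases hk : k = i
    · rw [hk, hi, mul_zero]
      exact mul_nonneg hM.le (hp.1 _)
    · have h1 : m ≤ S.d i k := by simpa [Ne.symm hk] using hx (i, k)
      have h2 : S.d i (S.next i p) ≤ M := by
        simpa [(S.next_ne i p).symm] using hy (i, S.next i p)
      calc m * p k ≤ S.d i k * p k := mul_le_mul_of_nonneg_right h1 (hp.1 _)
        _ ≤ _ := S.next_max i p k hk
        _ ≤ _ := mul_le_mul_of_nonneg_right h2 (hp.1 _)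
  have hsum := hp.2
  rw [Fin.sum_univ_three] at hsum
  rw [div_le_iff₀ (by positivity)]
  nlinarith [key 0, key 1, key 2]

variable {S}

lemma next_pos {i : Fin 3} {p : Fin 3 → ℝ} (hp : p ∈ stdSimplex ℝ (Fin 3)) (hi : p i = 0) :
    0 < p (S.next i p) := by
  obtain ⟨δ, h0, h⟩ := S.exists_le_next
  exact h0.trans_le (h i p hp hi)

/-- At a vertex of the simplex it does not matter which tank has been emptied. -/
lemma next_eq {i k : Fin 3} {p : Fin 3 → ℝ} (hp : p ∈ stdSimplex ℝ (Fin 3)) (hi : p i = 0)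
    (hk : p k = 0) : S.next i p = S.next k p := by
  by_cases hik : i = k
  · rw [hik]
  have h1 := next_pos (S := S) hp hi
  have h2 := next_pos (S := S) hp hk
  have h3 := S.next_ne i p
  have h4 := S.next_ne k p
  have h5 : S.next i p ≠ k := fun h => by rw [h, hk] at h1; exact h1.false
  have h6 : S.next k p ≠ i := fun h => by rw [h, hi] at h2; exact h2.false
  omega

/-! ### Every trajectory drains the first tank completely -/

lemma IsTrajectory.eq_drain {v : ℝ → Fin 3 → ℝ} {l : ℝ → Fin 3} (h : S.IsTrajectory v l)
    (hpos : 0 < v 0 (l 0)) {t : ℝ} (ht : t ∈ Icc 0 (3 / 2 * v 0 (l 0))) :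
    v t = drain (v 0) (l 0) t := by
  set τ := 3 / 2 * v 0 (l 0) with hτ
  have hτ0 : 0 < τ := by positivity
  have hcont : ∀ i, ContinuousOn (fun s => v s i) (Icc 0 τ) := fun i =>
    ((continuousOn_pi.1 h.continuousOn) i).mono Icc_subset_Ici_self
  -- Wherever the server is, a volume falls at a rate of at most 2/3. Hence the tank is nonempty
  -- before `τ`, and only then does `stay` fix the server there.
  have hlow : ∀ s ∈ Icc 0 τ, -v s (l 0) ≤ 2 / 3 * s - v 0 (l 0) := by
    refine fun s hs => image_le_of_deriv_right_le_deriv_boundary (hcont (l 0)).neg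
      (f' := fun s => -(1 / 3 - if l s = l 0 then 1 else 0))
      (fun x hx => (h.flow x hx.1 (l 0)).neg) (B := fun s => 2 / 3 * s - v 0 (l 0))
      (B' := fun _ => 2 / 3) (by simp) (by fun_prop)
      (fun x _ => ?_) (fun x _ => ?_) hs
    · simpa using ((((hasDerivAt_id x).const_mul (2 / 3)).sub_const (v 0 (l 0)))).hasDerivWithinAt
    · split_ifs <;> norm_num
  have hl : ∀ u ∈ Ico 0 τ, l u = l 0 := by
    refine h.stay 0 τ le_rfl hτ0 fun u hu => ?_
    have := hlow u ⟨hu.1, hu.2.le⟩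
    have := hu.2
    linarith
  ext i
  have hd : ∀ s, HasDerivAt (fun s => drain (v 0) (l 0) s i)
      (1 / 3 - if l 0 = i then 1 else 0) s := fun s => by
    simpa using hasDerivAt_drain (v 0) (l 0) 0 s i
  have := constant_of_has_deriv_right_zero (f := fun s => v s i - drain (v 0) (l 0) s i)
    ((hcont i).sub (fun s _ => (hd s).continuousAt.continuousWithinAt))
    (fun x hx => by
      have := (h.flow x hx.1 i).sub (hd x).hasDerivWithinAt
      rw [hl x hx, sub_self] at this
      exact this) t ht
  simp only [drain_zero, sub_self] at this
  linarith

lemma IsTrajectoryFrom.isFirstReturnTime {p : Fin 3 → ℝ} (hp : p ∈ boundaryΔ)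
    {v : ℝ → Fin 3 → ℝ} {l : ℝ → Fin 3} (h : S.IsTrajectoryFrom p v l) {i : Fin 3} (hi : p i = 0) :
    IsFirstReturnTime v (3 / 2 * p (S.next i p)) ∧
      v (3 / 2 * p (S.next i p)) = drain p (S.next i p) (3 / 2 * p (S.next i p)) := by
  obtain ⟨ht, h0, k, hk, hl⟩ := h
  rw [next_eq hp.1 hk hi] at hl
  have hpos := next_pos (S := S) hp.1 hi
  have key := fun t ht' => ht.eq_drain (by rw [h0, hl]; exact hpos) (t := t) ht'
  rw [h0, hl] at key
  set j := S.next i p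
  have hτ : 0 < 3 / 2 * p j := by positivity
  have hend := key _ ⟨hτ.le, le_rfl⟩
  refine ⟨⟨hτ, ⟨ht.mem_simplex _ hτ.le, j, ?_⟩, fun t ht' hb => ?_⟩, hend⟩
  · rw [hend, drain_self]; ring
  · obtain ⟨-, k, hk⟩ := hb
    rw [key t ⟨ht'.1.le, ht'.2.le⟩] at hk
    have h1 := ht'.1
    have h2 := ht'.2
    by_cases hjk : j = k
    · rw [← hjk, drain_self] at hk; linarith
    · rw [drain_of_ne _ hjk] at hk; linarith [hp.1.1 k]

/-! ### Existence of trajectories -/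

variable (S)

/-- The volumes and the position of the server just after the successive switchings. -/
noncomputable def phase (p : Fin 3 → ℝ) (j : Fin 3) : ℕ → (Fin 3 → ℝ) × Fin 3
  | 0 => (p, j)
  | n + 1 =>
    let q := phase p j n
    let r := drain q.1 q.2 (3 / 2 * q.1 q.2)
    (r, S.next q.2 r)

/-- The times of the successive switchings. -/
noncomputable def switchTime (p : Fin 3 → ℝ) (j : Fin 3) (n : ℕ) : ℝ :=
  ∑ m ∈ Finset.range n, 3 / 2 * (S.phase p j m).1 (S.phase p j m).2

/-- The number of switchings up to the time `t`. -/
noncomputable def phaseIndex (p : Fin 3 → ℝ) (j : Fin 3) (t : ℝ) : ℕ :=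
  sInf {n | t < S.switchTime p j (n + 1)}

/-- The volumes along the trajectory through the phases. -/
noncomputable def volumes (p : Fin 3 → ℝ) (j : Fin 3) (t : ℝ) : Fin 3 → ℝ :=
  drain (S.phase p j (S.phaseIndex p j t)).1 (S.phase p j (S.phaseIndex p j t)).2
    (t - S.switchTime p j (S.phaseIndex p j t))

/-- The position of the server along the trajectory through the phases. -/
noncomputable def position (p : Fin 3 → ℝ) (j : Fin 3) (t : ℝ) : Fin 3 :=
  (S.phase p j (S.phaseIndex p j t)).2

variable {S}

lemma switchTime_succ (p : Fin 3 → ℝ) (j : Fin 3) (n : ℕ) : S.switchTime p j (n + 1) =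
    S.switchTime p j n + 3 / 2 * (S.phase p j n).1 (S.phase p j n).2 :=
  Finset.sum_range_succ _ _

section Existence

variable {p : Fin 3 → ℝ} (hp : p ∈ stdSimplex ℝ (Fin 3)) {i : Fin 3} (hi : p i = 0)
include hp hi

lemma phase_spec (n : ℕ) : (S.phase p (S.next i p) n).1 ∈ stdSimplex ℝ (Fin 3) ∧
    ∃ k, (S.phase p (S.next i p) n).1 k = 0 ∧
      (S.phase p (S.next i p) n).2 = S.next k (S.phase p (S.next i p) n).1 := by
  induction n with
  | zero => exact ⟨hp, i, hi, rfl⟩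
  | succ n ih =>
    obtain ⟨h1, k, -, -⟩ := ih
    refine ⟨drain_mem h1 (mul_nonneg (by norm_num) (h1.1 _)) le_rfl,
      (S.phase p (S.next i p) n).2, ?_, rfl⟩
    simp only [phase, drain_self]
    ring

lemma phase_pos (n : ℕ) :
    0 < (S.phase p (S.next i p) n).1 (S.phase p (S.next i p) n).2 := by
  obtain ⟨h1, k, h2, h3⟩ := phase_spec (S := S) hp hi n
  rw [h3]
  exact next_pos h1 h2

lemma switchTime_strictMono : StrictMono (S.switchTime p (S.next i p)) :=
  strictMono_nat_of_lt_succ fun n => by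
    rw [switchTime_succ]
    linarith [phase_pos (S := S) hp hi n]

lemma exists_lt_switchTime (t : ℝ) : ∃ n, t < S.switchTime p (S.next i p) n := by
  obtain ⟨δ, h0, h⟩ := S.exists_le_next
  have key : ∀ n : ℕ, n * δ ≤ S.switchTime p (S.next i p) n := by
    intro n
    induction n with
    | zero => simp [switchTime]
    | succ n ih =>
      obtain ⟨h1, k, h2, h3⟩ := phase_spec (S := S) hp hi n
      have := h k _ h1 h2
      rw [switchTime_succ, h3]
      push_cast
      linarith
  obtain ⟨n, hn⟩ := exists_nat_gt (t / δ)
  exact ⟨n, ((div_lt_iff₀ h0).1 hn).trans_le (key n)⟩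

lemma phaseIndex_eq {n : ℕ} {t : ℝ}
    (ht : t ∈ Ico (S.switchTime p (S.next i p) n) (S.switchTime p (S.next i p) (n + 1))) :
    S.phaseIndex p (S.next i p) t = n := by
  have hm := switchTime_strictMono (S := S) hp hi
  refine le_antisymm (Nat.sInf_le ht.2) (le_csInf ⟨n, ht.2⟩ fun m hm' => ?_)
  have := hm.lt_iff_lt.1 (ht.1.trans_lt hm')
  omega

lemma exists_mem_phase {t : ℝ} (ht : 0 ≤ t) : ∃ n,
    t ∈ Ico (S.switchTime p (S.next i p) n) (S.switchTime p (S.next i p) (n + 1)) := by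
  classical
  have h := exists_lt_switchTime (S := S) hp hi t
  have hn := Nat.find_spec h
  rcases hN : Nat.find h with _ | n
  · rw [hN] at hn
    simp only [switchTime, Finset.range_zero, Finset.sum_empty] at hn
    linarith
  · rw [hN] at hn
    exact ⟨n, not_lt.1 (Nat.find_min h (by omega : n < Nat.find h)), hn⟩

lemma position_eq {n : ℕ} {t : ℝ}
    (ht : t ∈ Ico (S.switchTime p (S.next i p) n) (S.switchTime p (S.next i p) (n + 1))) :
    S.position p (S.next i p) t = (S.phase p (S.next i p) n).2 := by
  rw [position, phaseIndex_eq hp hi ht]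

/-- The right endpoint belongs to the next phase, whose initial volumes are by construction the
final ones of this phase. Having closed intervals lets the pieces be glued continuously. -/
lemma volumes_eq {n : ℕ} {t : ℝ}
    (ht : t ∈ Icc (S.switchTime p (S.next i p) n) (S.switchTime p (S.next i p) (n + 1))) :
    S.volumes p (S.next i p) t = drain (S.phase p (S.next i p) n).1
      (S.phase p (S.next i p) n).2 (t - S.switchTime p (S.next i p) n) := by
  rcases ht.2.lt_or_eq with h | h
  · rw [volumes, phaseIndex_eq hp hi ⟨ht.1, h⟩]
  · have hm := switchTime_strictMono (S := S) hp hi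
    have hidx := phaseIndex_eq (S := S) hp hi (n := n + 1) (t := t)
      ⟨h.ge, h ▸ hm (Nat.lt_succ_self _)⟩
    rw [volumes, hidx, ← h, sub_self, drain_zero, h, switchTime_succ, add_sub_cancel_left]
    rfl

lemma volumes_switchTime_succ (n : ℕ) :
    S.volumes p (S.next i p) (S.switchTime p (S.next i p) (n + 1)) =
      (S.phase p (S.next i p) (n + 1)).1 := by
  have hm := switchTime_strictMono (S := S) hp hi
  rw [volumes_eq hp hi (n := n + 1) ⟨le_rfl, (hm (Nat.lt_succ_self _)).le⟩, sub_self, drain_zero]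

lemma volumes_position_pos {n : ℕ} {t : ℝ}
    (ht : t ∈ Ico (S.switchTime p (S.next i p) n) (S.switchTime p (S.next i p) (n + 1))) :
    0 < S.volumes p (S.next i p) t (S.phase p (S.next i p) n).2 := by
  rw [volumes_eq hp hi ⟨ht.1, ht.2.le⟩, drain_self]
  have := ht.2
  rw [switchTime_succ] at this
  linarith

lemma volumes_phase_succ (n : ℕ) :
    S.volumes p (S.next i p) (S.switchTime p (S.next i p) (n + 1))
      (S.phase p (S.next i p) n).2 = 0 := by
  rw [volumes_switchTime_succ hp hi]
  simp only [phase, drain_self]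
  ring

lemma continuousOn_volumes : ContinuousOn (S.volumes p (S.next i p)) (Ici 0) := by
  have hm := switchTime_strictMono (S := S) hp hi
  have hz : S.switchTime p (S.next i p) 0 = 0 := by simp [switchTime]
  have hpiece : ∀ n, ContinuousOn (S.volumes p (S.next i p))
      (Icc (S.switchTime p (S.next i p) n) (S.switchTime p (S.next i p) (n + 1))) := fun n =>
    ContinuousOn.congr (((continuous_drain _ _).comp (continuous_sub_right _)).continuousOn)
      fun t ht => volumes_eq hp hi ht
  have hall : ∀ n, ContinuousOn (S.volumes p (S.next i p))
      (Icc 0 (S.switchTime p (S.next i p) n)) := by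
    intro n
    induction n with
    | zero => rw [hz, Icc_self]; exact continuousOn_singleton _ _
    | succ n ih =>
      rw [← Icc_union_Icc_eq_Icc (hz ▸ hm.monotone (Nat.zero_le n)) (hm (Nat.lt_succ_self n)).le]
      exact ih.union_of_isClosed (hpiece n) isClosed_Icc isClosed_Icc
  intro t ht
  obtain ⟨n, hn⟩ := exists_lt_switchTime (S := S) hp hi t
  refine (hall n t ⟨ht, hn.le⟩).mono_of_mem_nhdsWithin ?_
  exact mem_nhdsWithin.2 ⟨Iio _, isOpen_Iio, hn, fun u hu => ⟨hu.2, hu.1.le⟩⟩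

lemma isTrajectory_volumes :
    S.IsTrajectory (S.volumes p (S.next i p)) (S.position p (S.next i p)) where
  mem_simplex t ht := by
    obtain ⟨n, hn⟩ := exists_mem_phase (S := S) hp hi ht
    rw [volumes_eq hp hi ⟨hn.1, hn.2.le⟩]
    refine drain_mem (phase_spec hp hi n).1 (sub_nonneg.2 hn.1) ?_
    have := hn.2
    rw [switchTime_succ] at this
    linarith
  continuousOn := continuousOn_volumes hp hi
  right_continuous t ht := by
    obtain ⟨n, hn⟩ := exists_mem_phase (S := S) hp hi ht
    refine continuousWithinAt_const.congr_of_eventuallyEq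
      (f := fun _ => (S.phase p (S.next i p) n).2) ?_ (position_eq hp hi hn)
    filter_upwards [Ico_mem_nhdsGE hn.2] with u hu
    exact position_eq hp hi ⟨hn.1.trans hu.1, hu.2⟩
  flow t ht k := by
    obtain ⟨n, hn⟩ := exists_mem_phase (S := S) hp hi ht
    rw [position_eq hp hi hn]
    refine (hasDerivAt_drain (S.phase p (S.next i p) n).1 _ (S.switchTime p (S.next i p) n)
      t k).hasDerivWithinAt.congr_of_eventuallyEq ?_ ?_
    · filter_upwards [Ico_mem_nhdsGE hn.2] with u hu
      rw [volumes_eq hp hi ⟨hn.1.trans hu.1, hu.2.le⟩]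
    · rw [volumes_eq hp hi ⟨hn.1, hn.2.le⟩]
  stay s t hs hst hpos u hu := by
    obtain ⟨n, hn⟩ := exists_mem_phase (S := S) hp hi hs
    rw [position_eq hp hi hn] at hpos ⊢
    refine position_eq hp hi ⟨hn.1.trans hu.1, not_le.1 fun hle => ?_⟩
    have := hpos _ ⟨hn.2.le, hle.trans_lt hu.2⟩
    rw [volumes_phase_succ hp hi] at this
    exact this.false
  switch s t hs hst hpos hzero := by
    obtain ⟨n, hn⟩ := exists_mem_phase (S := S) hp hi hs
    rw [position_eq hp hi hn] at hpos hzero ⊢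
    -- A later `t` would contradict positivity at the switching time, an earlier one the emptiness
    -- at `t`.
    have ht : t = S.switchTime p (S.next i p) (n + 1) := by
      refine le_antisymm (not_lt.1 fun hlt => ?_) (not_lt.1 fun hlt => ?_)
      · have := hpos _ ⟨hn.2.le, hlt⟩
        rw [volumes_phase_succ hp hi] at this
        exact this.false
      · have := volumes_position_pos (S := S) hp hi ⟨hn.1.trans hst.le, hlt⟩
        exact this.ne' hzero
    have hm := switchTime_strictMono (S := S) hp hi
    rw [ht, volumes_switchTime_succ hp hi,
      position_eq hp hi (n := n + 1) ⟨le_rfl, hm (Nat.lt_succ_self _)⟩]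
    rfl

lemma isTrajectoryFrom_volumes :
    S.IsTrajectoryFrom p (S.volumes p (S.next i p)) (S.position p (S.next i p)) := by
  have hm := switchTime_strictMono (S := S) hp hi
  have hz : S.switchTime p (S.next i p) 0 = 0 := by simp [switchTime]
  have h1 := hm (Nat.lt_succ_self 0)
  refine ⟨isTrajectory_volumes hp hi, ?_, i, hi, ?_⟩
  · rw [volumes_eq hp hi (n := 0) ⟨hz.le, hz ▸ h1.le⟩, hz, sub_self, drain_zero]
    rfl
  · rw [position_eq hp hi (n := 0) ⟨hz.le, hz ▸ h1⟩]
    rfl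

end Existence

/-! ### The Poincaré map -/

lemma drain_mem_boundaryΔ {p : Fin 3 → ℝ} (hp : p ∈ stdSimplex ℝ (Fin 3)) (j : Fin 3) :
    drain p j (3 / 2 * p j) ∈ boundaryΔ :=
  ⟨drain_mem hp (mul_nonneg (by norm_num) (hp.1 _)) le_rfl, j, by rw [drain_self]; ring⟩

variable (S)

/-- The tank to which the server has moved is drained completely. -/
noncomputable def returnMap (p : boundaryΔ) : boundaryΔ :=
  ⟨_, drain_mem_boundaryΔ p.2.1 (S.next p.2.2.choose p)⟩

variable {S}

lemma coe_returnMap (p : boundaryΔ) {i : Fin 3} (hi : (p : Fin 3 → ℝ) i = 0) :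
    (S.returnMap p : Fin 3 → ℝ) =
      drain p (S.next i p) (3 / 2 * (p : Fin 3 → ℝ) (S.next i p)) := by
  rw [next_eq p.2.1 hi p.2.2.choose_spec]
  rfl

lemma isPoincareMap_returnMap : S.IsPoincareMap S.returnMap := by
  intro p
  obtain ⟨i, hi⟩ := p.2.2
  refine ⟨⟨_, _, isTrajectoryFrom_volumes p.2.1 hi⟩, fun v l h => ⟨3 / 2 * (p : Fin 3 → ℝ) (S.next i p), ?_⟩⟩
  rw [coe_returnMap p hi]
  exact h.isFirstReturnTime p.2 hi

end SwitchedServer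

/-! ### The Poincaré map in coordinates on the edges -/

/-- The point with coordinate `a` on the edge `v e = 0`. -/
noncomputable def edgePoint (e : Fin 3) (a : ℝ) : Fin 3 → ℝ :=
  fun i => if i = e then 0 else if i = e + 1 then 1 - a else a

lemma edgePoint_mem {e : Fin 3} {a : ℝ} (ha : a ∈ Icc (0 : ℝ) 1) :
    edgePoint e a ∈ boundaryΔ := by
  refine ⟨⟨fun i => ?_, ?_⟩, e, by simp [edgePoint]⟩
  · have := ha.1
    have := ha.2
    unfold edgePoint
    split_ifs <;> linarith
  · rw [Fin.sum_univ_three]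
    fin_cases e <;> simp [edgePoint]

lemma continuous_edgePoint (e : Fin 3) : Continuous (edgePoint e) := by
  refine continuous_pi fun i => ?_
  unfold edgePoint
  split_ifs <;> fun_prop

lemma exists_eq_edgePoint (p : boundaryΔ) :
    ∃ e, ∃ a ∈ Icc (0 : ℝ) 1, (p : Fin 3 → ℝ) = edgePoint e a := by
  obtain ⟨p, ⟨h0, h1⟩, e, he⟩ := p
  have hle : p (e + 2) ≤ 1 := by
    rw [← h1]
    exact Finset.single_le_sum (fun i _ => h0 i) (Finset.mem_univ _)
  refine ⟨e, p (e + 2), ⟨h0 _, hle⟩, ?_⟩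
  rw [Fin.sum_univ_three] at h1
  ext i
  fin_cases e <;> fin_cases i <;> simp [edgePoint] at he h1 ⊢ <;> linarith

/-- The two scaled volumes `d e (e + 1) * (1 - a)` and `d e (e + 2) * a` agree exactly at `a = A`.
Half of the drained volume ends up in each of the other tanks. -/
lemma SwitchedServer.returnMap_edgePoint (S : SwitchedServer) {e : Fin 3} {a A : ℝ}
    (hA : A ∈ Ioo (0 : ℝ) 1) (hd : S.d e (e + 2) / S.d e (e + 1) = (1 - A) / A)
    (p : boundaryΔ) (hp : (p : Fin 3 → ℝ) = edgePoint e a) :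
    (a ≤ A ∧ (S.returnMap p : Fin 3 → ℝ) = edgePoint (e + 1) ((1 - a) / 2)) ∨
      (A ≤ a ∧ (S.returnMap p : Fin 3 → ℝ) = edgePoint (e + 2) (1 - a / 2)) := by
  have hne1 : e ≠ e + 1 := by fin_cases e <;> decide
  have hne2 : e ≠ e + 2 := by fin_cases e <;> decide
  have v0 : edgePoint e a e = 0 := by simp [edgePoint]
  have v1 : edgePoint e a (e + 1) = 1 - a := by simp [edgePoint]
  have v2 : edgePoint e a (e + 2) = a := by simp [edgePoint]
  have hret := S.coe_returnMap p (i := e) (by rw [hp, v0])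
  rw [hp] at hret
  have hd1 := S.d_pos e (e + 1) hne1
  rw [div_eq_div_iff hd1.ne' hA.1.ne'] at hd
  have hmax := S.next_max e (edgePoint e a)
  have hcase : S.next e (edgePoint e a) = e + 1 ∨ S.next e (edgePoint e a) = e + 2 := by
    have := S.next_ne e (edgePoint e a)
    generalize S.next e (edgePoint e a) = j at this
    revert this
    clear * -
    revert e j
    decide
  rcases hcase with h | h
  · left
    have := hmax (e + 2) hne2.symm
    rw [h, v1, v2] at this
    constructor
    · have h1 := mul_le_mul_of_nonneg_right this hA.1.le
      have h2 : 0 ≤ S.d e (e + 1) * (A - a) := by linear_combination h1 - a * hd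
      linarith [(mul_nonneg_iff_of_pos_left hd1).1 h2]
    · rw [hret, h, v1]
      ext i
      clear * -
      fin_cases e <;> fin_cases i <;> simp [drain, edgePoint] <;> ring
  · right
    have := hmax (e + 1) hne1.symm
    rw [h, v1, v2] at this
    constructor
    · have h1 := mul_le_mul_of_nonneg_right this hA.1.le
      have h2 : 0 ≤ S.d e (e + 1) * (a - A) := by linear_combination h1 + a * hd
      linarith [(mul_nonneg_iff_of_pos_left hd1).1 h2]
    · rw [hret, h, v2]
      ext i
      clear * -
      fin_cases e <;> fin_cases i <;> simp [drain, edgePoint] <;> ring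

/-! ### Convergence to a cycle of length four -/

section Dynamics

variable {F : boundaryΔ → boundaryΔ} {A : Fin 3 → ℝ}
  (hF : ∀ (e : Fin 3) (a : ℝ) (p : boundaryΔ), (p : Fin 3 → ℝ) = edgePoint e a →
    (a ≤ A e ∧ (F p : Fin 3 → ℝ) = edgePoint (e + 1) ((1 - a) / 2)) ∨
      (A e ≤ a ∧ (F p : Fin 3 → ℝ) = edgePoint (e + 2) (1 - a / 2)))
  (h0 : A 0 ∈ Icc (33 / 64 : ℝ) (36 / 64)) (h1 : A 1 ∈ Icc (17 / 64 : ℝ) (20 / 64))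
  (h2 : A 2 ∈ Icc (49 / 64 : ℝ) (52 / 64))
include hF h0 h1 h2

lemma return_cycle {a : ℝ} (ha : a ∈ Icc (1 / 3 : ℝ) (3 / 4)) (p : boundaryΔ)
    (hp : (p : Fin 3 → ℝ) = edgePoint 2 a) :
    (F p : Fin 3 → ℝ) = edgePoint 0 ((1 - a) / 2) ∧
    (F (F p) : Fin 3 → ℝ) = edgePoint 1 ((1 + a) / 4) ∧
    (F (F (F p)) : Fin 3 → ℝ) = edgePoint 0 ((7 - a) / 8) ∧
    (F (F (F (F p))) : Fin 3 → ℝ) = edgePoint 2 ((9 + a) / 16) := by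
  obtain ⟨ha1, ha2⟩ := ha
  obtain ⟨h01, h02⟩ := h0
  obtain ⟨h11, h12⟩ := h1
  obtain ⟨h21, h22⟩ := h2
  have e1 : (F p : Fin 3 → ℝ) = edgePoint 0 ((1 - a) / 2) := by
    rcases hF _ _ _ hp with ⟨h, h'⟩ | ⟨h, -⟩
    · exact h'
    · linarith
  have e2 : (F (F p) : Fin 3 → ℝ) = edgePoint 1 ((1 + a) / 4) := by
    rcases hF _ _ _ e1 with ⟨h, h'⟩ | ⟨h, -⟩
    · rw [h']; congr 1; ring
    · linarith
  have e3 : (F (F (F p)) : Fin 3 → ℝ) = edgePoint 0 ((7 - a) / 8) := by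
    rcases hF _ _ _ e2 with ⟨h, -⟩ | ⟨h, h'⟩
    · linarith
    · rw [h']; congr 1; ring
  refine ⟨e1, e2, e3, ?_⟩
  rcases hF _ _ _ e3 with ⟨h, -⟩ | ⟨h, h'⟩
  · linarith
  · rw [h']; congr 1; ring

lemma exists_iterate_mem_edge_two (p : boundaryΔ) :
    ∃ m, ∃ a ∈ Icc (1 / 3 : ℝ) (3 / 4), (F^[m] p : Fin 3 → ℝ) = edgePoint 2 a := by
  obtain ⟨h01, h02⟩ := h0
  obtain ⟨h11, h12⟩ := h1
  obtain ⟨h21, h22⟩ := h2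
  have step : ∀ q : boundaryΔ,
      (∃ m, ∃ a ∈ Icc (1 / 3 : ℝ) (3 / 4), (F^[m] (F q) : Fin 3 → ℝ) = edgePoint 2 a) →
      ∃ m, ∃ a ∈ Icc (1 / 3 : ℝ) (3 / 4), (F^[m] q : Fin 3 → ℝ) = edgePoint 2 a :=
    fun q ⟨m, h⟩ => ⟨m + 1, h⟩
  -- The bounds 33/64 for `A 0` and 20/64 for `A 1` give entry values at most 95/128 and at least
  -- 11/32, hence the segment from 1/3 to 3/4.
  have upper : ∀ (q : boundaryΔ) a, a ≤ 1 → A 0 ≤ a → (F q : Fin 3 → ℝ) = edgePoint 2 (1 - a / 2) →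
      ∃ m, ∃ a ∈ Icc (1 / 3 : ℝ) (3 / 4), (F^[m] q : Fin 3 → ℝ) = edgePoint 2 a :=
    fun q a h h' hq => ⟨1, _, ⟨by linarith, by linarith⟩, hq⟩
  have lower : ∀ (q : boundaryΔ) a, 0 ≤ a → a ≤ A 1 →
      (F q : Fin 3 → ℝ) = edgePoint 2 ((1 - a) / 2) →
      ∃ m, ∃ a ∈ Icc (1 / 3 : ℝ) (3 / 4), (F^[m] q : Fin 3 → ℝ) = edgePoint 2 a :=
    fun q a h h' hq => ⟨1, _, ⟨by linarith, by linarith⟩, hq⟩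
  have edge0 : ∀ (q : boundaryΔ) a, a ∈ Icc (0 : ℝ) 1 → (q : Fin 3 → ℝ) = edgePoint 0 a →
      ∃ m, ∃ a ∈ Icc (1 / 3 : ℝ) (3 / 4), (F^[m] q : Fin 3 → ℝ) = edgePoint 2 a := by
    rintro q a ⟨ha, ha'⟩ hq
    rcases hF _ _ _ hq with ⟨h, hq1⟩ | ⟨h, hq1⟩
    · apply step
      rcases hF _ _ _ hq1 with ⟨h, hq2⟩ | ⟨h, hq2⟩
      · exact lower _ _ (by linarith) h hq2
      · apply step
        -- Two steps from edge 0 back to itself end at a coordinate of at least 3/4, above its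
        -- threshold.
        rcases hF _ _ _ hq2 with ⟨h, -⟩ | ⟨h, hq3⟩
        · change _ ≤ A 0 at h
          linarith
        · exact upper _ _ (by linarith) h hq3
    · exact upper _ _ ha' h hq1
  have edge1 : ∀ (q : boundaryΔ) a, a ∈ Icc (0 : ℝ) 1 → (q : Fin 3 → ℝ) = edgePoint 1 a →
      ∃ m, ∃ a ∈ Icc (1 / 3 : ℝ) (3 / 4), (F^[m] q : Fin 3 → ℝ) = edgePoint 2 a := by
    rintro q a ⟨ha, ha'⟩ hq
    rcases hF _ _ _ hq with ⟨h, hq1⟩ | ⟨h, hq1⟩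
    · exact lower _ _ ha h hq1
    · exact step _ (edge0 _ _ ⟨by linarith, by linarith⟩ hq1)
  obtain ⟨e, a, ⟨ha, ha'⟩, hp⟩ := exists_eq_edgePoint p
  fin_cases e
  · exact edge0 _ _ ⟨ha, ha'⟩ hp
  · exact edge1 _ _ ⟨ha, ha'⟩ hp
  · rcases hF _ _ _ hp with ⟨h, hq⟩ | ⟨h, hq⟩
    · exact step _ (edge0 _ _ ⟨by linarith, by linarith⟩ hq)
    · exact step _ (edge1 _ _ ⟨by linarith, by linarith⟩ hq)

lemma iterate_four_mul {a : ℝ} (ha : a ∈ Icc (1 / 3 : ℝ) (3 / 4)) (p : boundaryΔ)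
    (hp : (p : Fin 3 → ℝ) = edgePoint 2 a) (n : ℕ) :
    3 / 5 + (a - 3 / 5) * (1 / 16) ^ n ∈ Icc (1 / 3 : ℝ) (3 / 4) ∧
      (F^[4 * n] p : Fin 3 → ℝ) = edgePoint 2 (3 / 5 + (a - 3 / 5) * (1 / 16) ^ n) := by
  induction n with
  | zero =>
    rw [pow_zero, mul_one, add_sub_cancel]
    exact ⟨ha, hp⟩
  | succ n ih =>
    have hstep : 3 / 5 + (a - 3 / 5) * (1 / 16) ^ (n + 1) =
        (9 + (3 / 5 + (a - 3 / 5) * (1 / 16) ^ n)) / 16 := by ring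
    rw [hstep]
    refine ⟨⟨by linarith [ih.1.1], by linarith [ih.1.2]⟩, ?_⟩
    rw [show 4 * (n + 1) = 4 + 4 * n by ring, Function.iterate_add_apply]
    exact (return_cycle hF h0 h1 h2 ih.1 _ ih.2).2.2.2

/-- Every orbit converges to the limit cycle. -/
lemma exists_tendsto_cycle (p : boundaryΔ) : ∃ q : Fin 4 → boundaryΔ,
    (∀ r, (q r : Fin 3 → ℝ) =
      ![edgePoint 2 (3 / 5), edgePoint 0 (1 / 5), edgePoint 1 (2 / 5), edgePoint 0 (4 / 5)] r) ∧
    Tendsto (fun k => F^[k] p) atTop (𝓝ˢ (range q)) := by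
  obtain ⟨m, a, ha, hp⟩ := exists_iterate_mem_edge_two hF h0 h1 h2 p
  set b : ℕ → ℝ := fun n => 3 / 5 + (a - 3 / 5) * (1 / 16) ^ n with hb
  have hbt : Tendsto b atTop (𝓝 (3 / 5)) := by
    have := ((tendsto_pow_atTop_nhds_zero_of_lt_one (r := (1 / 16 : ℝ)) (by norm_num)
      (by norm_num)).const_mul (a - 3 / 5)).const_add (3 / 5)
    rwa [mul_zero, add_zero] at this
  have hcyc := iterate_four_mul hF h0 h1 h2 ha _ hp
  have hret := fun n => return_cycle hF h0 h1 h2 (hcyc n).1 _ (hcyc n).2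
  have hmem : ∀ r : Fin 4, ![edgePoint 2 (3 / 5), edgePoint 0 (1 / 5), edgePoint 1 (2 / 5),
      edgePoint 0 (4 / 5)] r ∈ boundaryΔ := by
    intro r
    fin_cases r <;> exact edgePoint_mem ⟨by norm_num, by norm_num⟩
  refine ⟨fun r => ⟨_, hmem r⟩, fun r => rfl, ?_⟩
  -- Each residue class of times modulo 4 converges to its own point of the cycle.
  have hlim : ∀ r : Fin 4, Tendsto (fun n => F^[r + 4 * n] (F^[m] p)) atTop
      (𝓝 ⟨_, hmem r⟩) := by
    intro r
    rw [tendsto_subtype_rng]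
    have aux : ∀ (e : Fin 3) (g : ℝ → ℝ) (y : ℝ), Continuous g → g (3 / 5) = y →
        Tendsto (fun n => edgePoint e (g (b n))) atTop (𝓝 (edgePoint e y)) := by
      rintro e g y hg rfl
      exact (((continuous_edgePoint e).comp hg).tendsto _).comp hbt
    fin_cases r
    · refine (aux 2 id (3 / 5) continuous_id rfl).congr fun n => ?_
      change _ = ((F^[0 + 4 * n] (F^[m] p) : boundaryΔ) : Fin 3 → ℝ)
      rw [zero_add]
      exact (hcyc n).2.symm
    · refine (aux 0 (fun a => (1 - a) / 2) (1 / 5) (by fun_prop) (by norm_num)).congr fun n => ?_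
      change _ = ((F^[1 + 4 * n] (F^[m] p) : boundaryΔ) : Fin 3 → ℝ)
      rw [Function.iterate_add_apply]
      exact (hret n).1.symm
    · refine (aux 1 (fun a => (1 + a) / 4) (2 / 5) (by fun_prop) (by norm_num)).congr fun n => ?_
      change _ = ((F^[2 + 4 * n] (F^[m] p) : boundaryΔ) : Fin 3 → ℝ)
      rw [Function.iterate_add_apply]
      exact (hret n).2.1.symm
    · refine (aux 0 (fun a => (7 - a) / 8) (4 / 5) (by fun_prop) (by norm_num)).congr fun n => ?_
      change _ = ((F^[3 + 4 * n] (F^[m] p) : boundaryΔ) : Fin 3 → ℝ)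
      rw [Function.iterate_add_apply]
      exact (hret n).2.2.1.symm
  intro U hU
  rw [mem_nhdsSet_iff_forall] at hU
  have hev := eventually_all.2 fun r => (hlim r).eventually (hU _ ⟨r, rfl⟩)
  obtain ⟨N, hN⟩ := eventually_atTop.1 hev
  refine eventually_atTop.2 ⟨m + 4 * N, fun k hk => ?_⟩
  have := hN ((k - m) / 4) (by omega) ⟨(k - m) % 4, Nat.mod_lt _ (by norm_num)⟩
  rw [← Function.iterate_add_apply] at this
  simp only [show (k - m) % 4 + 4 * ((k - m) / 4) + m = k by omega] at this
  exact this

lemma finite_globalAttractor : (globalAttractor F).Finite := by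
  have hfin : (range ![edgePoint 2 (3 / 5), edgePoint 0 (1 / 5), edgePoint 1 (2 / 5),
    edgePoint 0 (4 / 5)]).Finite := finite_range _
  refine (hfin.preimage (f := ((↑) : boundaryΔ → Fin 3 → ℝ))
    Subtype.val_injective.injOn).subset ?_
  refine iUnion_subset fun x y hy => ?_
  rw [mem_omegaLimit_singleton_iff_mapClusterPt] at hy
  obtain ⟨q, hq, hle⟩ := exists_tendsto_cycle hF h0 h1 h2 x
  -- The cycle is finite, hence closed, so a point off it is separated from it by neighbourhoods and
  -- cannot be a cluster point.
  have hcl : ClusterPt y (𝓝ˢ (range q)) := ClusterPt.mono hy hle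
  by_contra hne
  refine hcl.ne (disjoint_iff.1 (disjoint_nhds_nhdsSet.2 ?_))
  rw [(finite_range q).isClosed.closure_eq]
  rintro ⟨r, rfl⟩
  exact hne ⟨r, (hq r).symm⟩

end Dynamics

theorem corollary2 (x₁ x₂ x₃ d₁ d₂ d₃ : ℝ)
    (hx₁ : x₁ = champernowne4 - 1 / 4) (hx₂ : x₂ = champernowne4)
    (hx₃ : x₃ = champernowne4 + 1 / 2)
    (hd₁ : d₁ = 1 / (3 * x₁) - 1) (hd₂ : d₂ = (2 - 3 * x₂) / (3 * x₂ - 1))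
    (hd₃ : d₃ = (3 - 3 * x₃) / (3 * x₃ - 2)) :
    (x₁ ∈ Set.Ioo 0 (1 / 3) ∧ x₂ ∈ Set.Ioo (1 / 3) (2 / 3) ∧ x₃ ∈ Set.Ioo (2 / 3) 1 ∧
      0 < d₁ ∧ 0 < d₂ ∧ 0 < d₃) ∧
    ∀ S : SwitchedServer,
      S.d 0 2 / S.d 0 1 = d₁ → S.d 1 0 / S.d 1 2 = d₂ → S.d 2 1 / S.d 2 0 = d₃ →
      ∃ F : boundaryΔ → boundaryΔ, S.IsPoincareMap F ∧ (globalAttractor F).Finite := by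

  obtain ⟨hc1, hc2⟩ := champernowne4_mem
  subst hx₁ hx₂ hx₃
  set c := champernowne4
  -- The thresholds `3 * x₁`, `3 * x₂ - 1` and `3 * x₃ - 2` in terms of `c`; each parameter ratio is
  -- `(1 - A) / A`.
  have hA0 : 3 * c - 3 / 4 ∈ Icc (33 / 64 : ℝ) (36 / 64) := ⟨by linarith, by linarith⟩
  have hA1 : 3 * c - 1 ∈ Icc (17 / 64 : ℝ) (20 / 64) := ⟨by linarith, by linarith⟩
  have hA2 : 3 * c - 1 / 2 ∈ Icc (49 / 64 : ℝ) (52 / 64) := ⟨by linarith, by linarith⟩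
  have e0 : d₁ = (1 - (3 * c - 3 / 4)) / (3 * c - 3 / 4) := by
    have : 3 * c - 3 / 4 ≠ 0 := by linarith [hA0.1]
    rw [hd₁, show 3 * (c - 1 / 4) = 3 * c - 3 / 4 by ring, sub_div, div_self this]
  have e1 : d₂ = (1 - (3 * c - 1)) / (3 * c - 1) := by
    rw [hd₂]; congr 1; ring
  have e2 : d₃ = (1 - (3 * c - 1 / 2)) / (3 * c - 1 / 2) := by
    rw [hd₃]; congr 1 <;> ring
  refine ⟨⟨⟨by linarith, by linarith⟩, ⟨by linarith, by linarith⟩, ⟨by linarith, by linarith⟩,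
    ?_, ?_, ?_⟩, fun S hS1 hS2 hS3 => ⟨S.returnMap, S.isPoincareMap_returnMap, ?_⟩⟩
  · rw [e0]; exact div_pos (by linarith) (by linarith)
  · rw [e1]; exact div_pos (by linarith) (by linarith)
  · rw [e2]; exact div_pos (by linarith) (by linarith)
  · refine finite_globalAttractor (A := ![3 * c - 3 / 4, 3 * c - 1, 3 * c - 1 / 2])
      (fun e a p hp => ?_) hA0 hA1 hA2
    refine S.returnMap_edgePoint ?_ ?_ p hp
    · fin_cases e
      · exact ⟨by simpa using by linarith, by simpa using by linarith⟩
      · exact ⟨by simpa using by linarith, by simpa using by linarith⟩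
      · exact ⟨by simpa using by linarith, by simpa using by linarith⟩
    · fin_cases e
      · exact hS1.trans e0
      · exact hS2.trans e1
      · exact hS3.trans e2
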